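/- Fix integers $D\ge 1$, $d,k,R,r_0\ge 0$ and a real $M$. For $n\ge1$ consider the periodic hypercubic lattice $\Lambda_n=(\mathbb Z/n\mathbb Z)^D$ with $N=n^D$ sites, one $d$-level spin (Hilbert space $\mathbb C^d$) at every site, and the distance $|\mathbf i-\mathbf i'|=\sum_{l=1}^D|i_l-i'_l|$, where each coordinate difference is measured around the periodic direction. An operator is called local at $\mathbf i$ with radius $R$ if it acts non-trivially only on sites within distance $R$ of $\mathbf i$; $\|\cdot\|$ is the operator norm. There is a constant $C>0$ depending only on $D,d,k,R,M,r_0$ such that for every $\xi_0>0$ there is $n_0$ such that the following holds for all $n\ge n_0$ and all $\xi\ge\xi_0$. Let $H=\sum_{\mathbf i\in\Lambda_n}H_{\mathbf i}$ be a Hamiltonian with each $H_{\mathbf i}$ Hermitian and local at $\mathbf i$ with radius $k$; suppose that $H$ is invariant under all lattice translations and that its spectrum is simple (non-degenerate). Let $\rho$ be a density matrix with $[\rho,H]=0$ such that, for some $f:\mathbb Z_{\ge0}\to\mathbb R$ with $f(r)\le M e^{-r/\xi}$ for all $r>r_0$, $$|\operatorname{tr}(\rho XY)-\operatorname{tr}(\rho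 X)\operatorname{tr}(\rho Y)|\le\|X\|\,\|Y\|\,f(|\mathbf i-\mathbf i'|)$$ for all sites $\mathbf i,\mathbf i'$ and all operators $X,Y$ that are local with radius $R$ at $\mathbf i$ and $\mathbf i'$, respectively. Then for all sites $\mathbf i,\mathbf i'$ and all (not necessarily Hermitian) operators $A,B$ that are local with radius $R$ at $\mathbf i$ and $\mathbf i'$, respectively, with $A(t)=e^{iHt}Ae^{-iHt}$, the limit below exists and $$\left|\lim_{\tau\to+\infty}\frac1\tau\int_0^\tau\operatorname{tr}(\rho A(t)B)\,\mathrm dt-\operatorname{tr}(\rho A)\operatorname{tr}(\rho B)\right|\le C\,\|A\|\,\|B\|\;\xi^{\frac{2D}{D+1}}N^{-\frac2{D+1}}\log^2N .$$ That is, the time-averaged local temporal correlator deviates from the product of expectations by $O\big(\xi^{2D/(D+1)}N^{-2/(D+1)}\log^2N\big)$. -/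

import Mathlib

open scoped ComplexOrder

noncomputable section

namespace SpinLattice

/-- Sites of the periodic hypercubic lattice of length `n` in `D` dimensions; there are
`n ^ D` of them. -/
abbrev Site (D n : ℕ) : Type := Fin D → ZMod n

/-- Configurations of the lattice of `d`-level spins. They label the product basis of
the Hilbert space, the tensor product of one copy of `ℂ ^ d` per site. -/
abbrev Config (D n d : ℕ) : Type := Site D n → Fin d

/-- Operators on the Hilbert space, as matrices in the product basis. -/
abbrev Op (D n d : ℕ) : Type := Matrix (Config D n d) (Config D n d) ℂ

variable {D n d : ℕ}

/-- The lattice distance `∑ l, |i l - j l|`, where the difference of two coordinates is measured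
around the periodic direction (`ZMod.valMinAbs` is the representative of least absolute value). -/
def dist (i j : Site D n) : ℕ := ∑ l, (i l - j l).valMinAbs.natAbs

/-- The sites at distance at most `R` from `i`. -/
def ball (i : Site D n) (R : ℕ) : Set (Site D n) := {j | dist i j ≤ R}

open Classical in
/-- `X` acts only on the spins in `S`: it is `x ⊗ 1` for an operator `x` on the spins in `S`. -/
def SupportedOn (S : Set (Site D n)) (X : Op D n d) : Prop :=
  ∃ x : Matrix (S → Fin d) (S → Fin d) ℂ, ∀ σ τ : Config D n d,
    X σ τ = if ∀ j, j ∉ S → σ j = τ j then x (fun j => σ j) (fun j => τ j) else 0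

/-- The operator `X` translated by the lattice vector `a`. -/
def translate (a : Site D n) (X : Op D n d) : Op D n d :=
  Matrix.of fun σ τ => X (fun j => σ (j + a)) (fun j => τ (j + a))

/-- Invariance under all lattice translations. -/
def IsTranslationInvariant (X : Op D n d) : Prop := ∀ a, translate a X = X

variable [NeZero n]

/-- A local Hamiltonian of range `k`: a sum over the sites of Hermitian terms, the term at `i`
acting within distance `k` of `i`. -/
def IsLocalHamiltonian (k : ℕ) (H : Op D n d) : Prop :=
  ∃ h : Site D n → Op D n d,
    (∀ i, (h i).IsHermitian ∧ SupportedOn (ball i k) (h i)) ∧ H = ∑ i, h i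

/-- All eigenvalues of `H` are non-degenerate. -/
def HasSimpleSpectrum (H : Op D n d) : Prop :=
  ∀ μ : ℂ, Module.finrank ℂ (Module.End.eigenspace (Matrix.toLin' H) μ) ≤ 1

/-- Density matrices. -/
def IsDensityMatrix (ρ : Op D n d) : Prop := ρ.PosSemidef ∧ ρ.trace = 1

/-- The operator norm with respect to the Hilbert space norm. -/
def opNorm (X : Op D n d) : ℝ := ‖Matrix.toEuclideanCLM (𝕜 := ℂ) X‖

/-- The expectation value `tr (ρ X)`. -/
def expect (ρ X : Op D n d) : ℂ := (ρ * X).trace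

/-- Two-point correlations in `ρ` decay as `f`, for operators supported within distance `R`
of the respective site. -/
def HasCorrelationDecay (R : ℕ) (ρ : Op D n d) (f : ℕ → ℝ) : Prop :=
  ∀ (i j : Site D n) (X Y : Op D n d), SupportedOn (ball i R) X → SupportedOn (ball j R) Y →
    ‖expect ρ (X * Y) - expect ρ X * expect ρ Y‖ ≤ opNorm X * opNorm Y * f (dist i j)

/-- The time evolution `exp (i H t) X exp (-i H t)` in the Heisenberg picture. -/
def evolve (H : Op D n d) (t : ℝ) (X : Op D n d) : Op D n d :=
  NormedSpace.exp ((Complex.I * t) • H) * X * NormedSpace.exp (-(Complex.I * t) • H)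

/-- The average over the times in `[0, τ]` of the temporal correlator `tr (ρ A(t) B)`. -/
def timeAverage (H ρ A B : Op D n d) (τ : ℝ) : ℂ :=
  (1 / τ : ℂ) * ∫ t in (0 : ℝ)..τ, expect ρ (evolve H t A * B)

end SpinLattice

end

/-! Since `H` has simple spectrum and `ρ` commutes with it, both are diagonal in one orthonormal
basis, with weights `p m` for `ρ`. Time averaging removes every term with a nonzero energy
difference, so the limit is `∑ m, p m * A_mm * B_mm` (`tendsto_timeAverage`), and its deviation from
the product of expectations is the covariance of the diagonal entries under `p`. A lattice
translation can only multiply each eigenvector by a phase, so `A_mm` is also the diagonal entry of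
the spatial mean of all translates of `A` (`conj_submatrix_apply_self`). Its variance under `p` is
thus at most the variance of that mean in `ρ`, which decay of correlations bounds by `O((1 + ξ) ^ D
/ N)` (`card_sq_mul_sum_fluctuation_le`, `sum_correlation_le`). Cauchy-Schwarz carries this over to
the covariance. With `x = ξ ^ D / N` the claimed rate is `x ^ (2 / (D + 1))` times `log² N`. It is
weaker than `x` when `x ≤ 1`, and the trivial bound `2 ‖A‖ ‖B‖` covers `x ≥ 1`. The logarithm
absorbs the constant that depends on `ξ₀`. -/

namespace SpinLattice

/-! ### Common eigenbases, symmetries and operator norms of matrices. -/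

section Diagonalization

open Matrix

variable {ι : Type*} [Fintype ι] [DecidableEq ι]

theorem apply_eq_zero_of_commute_diagonal {e : ι → ℂ} (he : Function.Injective e)
    {X : Matrix ι ι ℂ} (hX : X * diagonal e = diagonal e * X) {i j : ι} (hij : i ≠ j) :
    X i j = 0 := by
  have h := congrFun (congrFun hX i) j
  rw [mul_diagonal, diagonal_mul] at h
  have h' : (e i - e j) * X i j = 0 := by linear_combination -h
  exact (mul_eq_zero.1 h').resolve_left (sub_ne_zero.2 (he.ne hij))

theorem eq_diagonal_of_commute_diagonal {e : ι → ℂ} (he : Function.Injective e)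
    {X : Matrix ι ι ℂ} (hX : X * diagonal e = diagonal e * X) :
    X = diagonal fun i => X i i := by
  ext i j
  rcases eq_or_ne i j with rfl | hij
  · simp
  · rw [diagonal_apply_ne _ hij, apply_eq_zero_of_commute_diagonal he hX hij]

/-- A repeated eigenvalue would put two orthonormal eigenvectors into an eigenspace that is at most
a line. -/
theorem eigenvalues_injective_of_finrank_eigenspace_le_one {H : Matrix ι ι ℂ}
    (hH : H.IsHermitian)
    (hs : ∀ μ : ℂ, Module.finrank ℂ (Module.End.eigenspace (toLin' H) μ) ≤ 1) :
    Function.Injective hH.eigenvalues := by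
  intro i j hij
  by_contra hne
  have hmem : ∀ m, (hH.eigenvectorBasis m).ofLp ∈
      Module.End.eigenspace (toLin' H) (hH.eigenvalues m : ℂ) := fun m => by
    rw [Module.End.mem_eigenspace_iff, toLin'_apply, hH.mulVec_eigenvectorBasis]
    rfl
  let v : Module.End.eigenspace (toLin' H) (hH.eigenvalues i : ℂ) := ⟨_, hmem i⟩
  let w : Module.End.eigenspace (toLin' H) (hH.eigenvalues i : ℂ) := ⟨_, hij ▸ hmem j⟩
  have hv : v ≠ 0 := fun h => by
    have h' : (hH.eigenvectorBasis i).ofLp = 0 := congrArg Subtype.val h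
    exact hH.eigenvectorBasis.orthonormal.ne_zero i (by ext m; exact congrFun h' m)
  obtain ⟨c, hc⟩ := (finrank_le_one_iff.1 (hs (hH.eigenvalues i))).elim fun u hu =>
    show ∃ c : ℂ, w = c • v by
      obtain ⟨a, ha⟩ := hu v
      obtain ⟨b, hb⟩ := hu w
      have ha0 : a ≠ 0 := by rintro rfl; exact hv (by rw [← ha, zero_smul])
      exact ⟨b * a⁻¹, by rw [← ha, ← hb, smul_smul, mul_assoc, inv_mul_cancel₀ ha0, mul_one]⟩
  have hc' : hH.eigenvectorBasis j = c • hH.eigenvectorBasis i := by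
    ext m
    exact congrFun (congrArg Subtype.val hc) m
  have h1 : inner ℂ (hH.eigenvectorBasis j) (hH.eigenvectorBasis i) = (0 : ℂ) :=
    hH.eigenvectorBasis.orthonormal.2 (Ne.symm hne)
  have h2 : inner ℂ (hH.eigenvectorBasis j) (hH.eigenvectorBasis j) = (0 : ℂ) := by
    conv_lhs => rw [hc', inner_smul_right, ← hc', h1, mul_zero]
  exact hH.eigenvectorBasis.orthonormal.ne_zero j (inner_self_eq_zero.1 h2)

/-- A Hermitian matrix with simple spectrum and a density matrix commuting with it are
diagonal in a common orthonormal basis. -/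
theorem exists_simultaneous_diagonalization {H ρ : Matrix ι ι ℂ} (hH : H.IsHermitian)
    (hs : ∀ μ : ℂ, Module.finrank ℂ (Module.End.eigenspace (toLin' H) μ) ≤ 1)
    (hρ : ρ.PosSemidef) (htr : ρ.trace = 1) (hcomm : ρ * H = H * ρ) :
    ∃ U : Matrix ι ι ℂ, Uᴴ * U = 1 ∧ U * Uᴴ = 1 ∧ ∃ e : ι → ℝ, Function.Injective e ∧
      H = U * diagonal (fun i => (e i : ℂ)) * Uᴴ ∧ ∃ p : ι → ℝ, (∀ i, 0 ≤ p i) ∧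
        ∑ i, p i = 1 ∧ ρ = U * diagonal (fun i => (p i : ℂ)) * Uᴴ := by
  obtain ⟨U, hU⟩ : ∃ U, U = (hH.eigenvectorUnitary : Matrix ι ι ℂ) := ⟨_, rfl⟩
  have hU1 : Uᴴ * U = 1 := by
    rw [hU]; exact (Matrix.mem_unitaryGroup_iff').1 hH.eigenvectorUnitary.2
  have hU2 : U * Uᴴ = 1 := by
    rw [hU]; exact (Matrix.mem_unitaryGroup_iff).1 hH.eigenvectorUnitary.2
  have he := eigenvalues_injective_of_finrank_eigenspace_le_one hH hs
  have heq : H = U * diagonal (fun i => (hH.eigenvalues i : ℂ)) * Uᴴ := by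
    conv_lhs => rw [hH.spectral_theorem, Unitary.conjStarAlgAut_apply]
    rw [hU]; rfl
  refine ⟨U, hU1, hU2, hH.eigenvalues, he, heq, ?_⟩
  have hps : (Uᴴ * ρ * U).PosSemidef := hρ.conjTranspose_mul_mul_same U
  have hdiag : Uᴴ * ρ * U = diagonal fun i => (Uᴴ * ρ * U) i i := by
    refine eq_diagonal_of_commute_diagonal (e := fun i => (hH.eigenvalues i : ℂ))
      (fun i j h => he (Complex.ofReal_injective h)) ?_
    have h2 : diagonal (fun i => (hH.eigenvalues i : ℂ)) = Uᴴ * H * U := by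
      calc _ = (Uᴴ * U) * diagonal (fun i => (hH.eigenvalues i : ℂ)) * (Uᴴ * U) := by
            rw [hU1, one_mul, mul_one]
        _ = Uᴴ * (U * diagonal (fun i => (hH.eigenvalues i : ℂ)) * Uᴴ) * U := by
            simp only [mul_assoc]
        _ = _ := by rw [← heq]
    rw [h2]
    calc _ = Uᴴ * ρ * (U * Uᴴ) * H * U := by simp only [mul_assoc]
      _ = Uᴴ * (ρ * H) * U := by rw [hU2]; simp only [mul_assoc, mul_one]
      _ = Uᴴ * H * (U * Uᴴ) * ρ * U := by
        rw [hcomm, hU2]; simp only [mul_assoc, mul_one]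
      _ = _ := by simp only [mul_assoc]
  have hre : ∀ i, (((Uᴴ * ρ * U) i i).re : ℂ) = (Uᴴ * ρ * U) i i := fun i =>
    (Complex.eq_re_of_ofReal_le (r := 0) (by simpa using hps.diag_nonneg (i := i))).symm
  refine ⟨fun i => ((Uᴴ * ρ * U) i i).re,
    fun i => (Complex.nonneg_iff.1 (hps.diag_nonneg (i := i))).1, ?_, ?_⟩
  · have h : (Uᴴ * ρ * U).trace = 1 := by
      rw [mul_assoc, trace_mul_comm, mul_assoc, hU2, mul_one, htr]
    rw [← Complex.ofReal_inj, Complex.ofReal_sum, Complex.ofReal_one, ← h]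
    exact Finset.sum_congr rfl fun i _ => hre i
  · simp only [hre]
    rw [← hdiag]
    calc ρ = (U * Uᴴ) * ρ * (U * Uᴴ) := by rw [hU2, one_mul, mul_one]
      _ = _ := by simp only [mul_assoc]

variable {U : Matrix ι ι ℂ}

theorem trace_conj_diagonal_mul (U : Matrix ι ι ℂ) (p : ι → ℂ) (X : Matrix ι ι ℂ) :
    (U * diagonal p * Uᴴ * X).trace = ∑ i, p i * (Uᴴ * X * U) i i := by
  have : (U * diagonal p * Uᴴ * X).trace = (diagonal p * (Uᴴ * X * U)).trace := by
    rw [mul_assoc U, mul_assoc U, trace_mul_comm]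
    simp only [mul_assoc]
  rw [this]
  simp [trace, diagonal_mul]

theorem exp_smul_conj_diagonal (h1 : Uᴴ * U = 1) (h2 : U * Uᴴ = 1) (e : ι → ℂ) (c : ℂ) :
    NormedSpace.exp (c • (U * diagonal e * Uᴴ)) =
      U * diagonal (fun i => Complex.exp (c * e i)) * Uᴴ := by
  have hinv : U⁻¹ = Uᴴ := inv_eq_left_inv h1
  have hu : IsUnit U := IsUnit.of_mul_eq_one _ h2
  have : c • (U * diagonal e * Uᴴ) = U * diagonal (c • e) * U⁻¹ := by
    rw [hinv, diagonal_smul, mul_smul_comm, smul_mul_assoc]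
  rw [this, Matrix.exp_conj _ _ hu, Matrix.exp_diagonal, hinv]
  congr 3
  funext i
  rw [Pi.coe_exp, Complex.exp_eq_exp_ℂ]
  rfl

/-- A symmetry of a matrix with simple spectrum does not change the diagonal entries of other
matrices in the eigenbasis. -/
theorem conj_submatrix_apply_self (h1 : Uᴴ * U = 1) (h2 : U * Uᴴ = 1) {e : ι → ℂ}
    (he : Function.Injective e) (π : ι ≃ ι)
    (hH : (U * diagonal e * Uᴴ).submatrix π π = U * diagonal e * Uᴴ)
    (X : Matrix ι ι ℂ) (i : ι) :
    (Uᴴ * X.submatrix π π * U) i i = (Uᴴ * X * U) i i := by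
  -- `W` holds the permuted eigenvectors; by the symmetry it diagonalizes the same matrix with the
  -- same `e`.
  obtain ⟨W, hW⟩ : ∃ W, W = U.submatrix π id := ⟨_, rfl⟩
  have hWH : Wᴴ = Uᴴ.submatrix id π := by rw [hW, conjTranspose_submatrix]
  have hW1 : Wᴴ * W = 1 := by
    rw [hWH, hW, submatrix_mul_equiv, h1, submatrix_id_id]
  have hWe : W * diagonal e * Wᴴ = U * diagonal e * Uᴴ := by
    rw [← hH, hWH, hW, ← submatrix_mul_equiv _ _ _ (Equiv.refl ι),
      ← submatrix_mul_equiv _ _ _ (Equiv.refl ι)]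
    rfl
  -- The change of basis `V` commutes with `diagonal e`, hence is diagonal. Being unitary it
  -- consists of phases, which cancel in diagonal entries.
  obtain ⟨V, hV⟩ : ∃ V, V = Uᴴ * W := ⟨_, rfl⟩
  have hUV : U * V = W := by rw [hV, ← mul_assoc, h2, one_mul]
  have hVd := eq_diagonal_of_commute_diagonal he (X := V) <| by
    calc V * diagonal e = Uᴴ * (W * diagonal e * Wᴴ) * W := by
          simp only [hV, mul_assoc, hW1, mul_one]
      _ = (Uᴴ * U) * diagonal e * (Uᴴ * W) := by rw [hWe]; simp only [mul_assoc]
      _ = _ := by rw [h1, one_mul, hV]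
  have hX : Uᴴ * X * U = Vᴴ * (Uᴴ * X.submatrix π π * U) * V := by
    calc Uᴴ * X * U = Wᴴ * X.submatrix π π * W := by
          rw [hWH, hW, submatrix_mul_equiv, submatrix_mul_equiv, submatrix_id_id]
      _ = _ := by rw [← hUV, conjTranspose_mul]; simp only [mul_assoc]
  have hVV : Vᴴ * V = 1 := by
    calc Vᴴ * V = Wᴴ * (U * Uᴴ) * W := by
          rw [hV, conjTranspose_mul, conjTranspose_conjTranspose]; simp only [mul_assoc]
      _ = 1 := by rw [h2, mul_one, hW1]
  have hvi : star (V i i) * V i i = 1 := by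
    have := congrFun (congrFun hVV i) i
    rw [hVd, diagonal_conjTranspose, diagonal_mul_diagonal] at this
    simpa using this
  rw [hX]
  conv_rhs => rw [hVd, diagonal_conjTranspose, mul_diagonal, diagonal_mul]
  simp only [Pi.star_apply]
  linear_combination (-(Uᴴ * X.submatrix π π * U) i i) * hvi

/-- The right side is the squared norm of column `i` of `Uᴴ * X * U`; all entries but the diagonal
one are dropped. -/
theorem sq_norm_apply_self_le (h2 : U * Uᴴ = 1) (X : Matrix ι ι ℂ) (i : ι) :
    ‖(Uᴴ * X * U) i i‖ ^ 2 ≤ ((Uᴴ * (Xᴴ * X) * U) i i).re := by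
  have h : Uᴴ * (Xᴴ * X) * U = (Uᴴ * X * U)ᴴ * (Uᴴ * X * U) := by
    calc _ = Uᴴ * Xᴴ * (U * Uᴴ) * X * U := by rw [h2, mul_one]; simp only [mul_assoc]
      _ = _ := by
        simp only [conjTranspose_mul, conjTranspose_conjTranspose, mul_assoc]
  rw [h]
  generalize Uᴴ * X * U = Y
  have hY : ∀ j, (Yᴴ i j * Y j i).re = ‖Y j i‖ ^ 2 := fun j => by
    rw [conjTranspose_apply, ← Complex.normSq_eq_norm_sq, Complex.star_def,
      ← Complex.normSq_eq_conj_mul_self, Complex.ofReal_re]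
  rw [mul_apply, Complex.re_sum, Finset.sum_congr rfl fun j _ => hY j]
  exact Finset.single_le_sum (f := fun j => ‖Y j i‖ ^ 2)
    (fun j _ => sq_nonneg _) (Finset.mem_univ i)

theorem norm_apply_le_norm_toEuclideanCLM (X : Matrix ι ι ℂ) (i j : ι) :
    ‖X i j‖ ≤ ‖toEuclideanCLM (𝕜 := ℂ) X‖ := by
  have h := (toEuclideanCLM (𝕜 := ℂ) X).le_opNorm (EuclideanSpace.single j 1)
  rw [PiLp.norm_single, norm_one, mul_one] at h
  refine le_trans ?_ h
  have h' := PiLp.norm_apply_le (toEuclideanCLM (𝕜 := ℂ) X (EuclideanSpace.single j 1)) i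
  simpa using h'

open scoped Matrix.Norms.L2Operator in
theorem norm_toEuclideanCLM_conj (h1 : Uᴴ * U = 1) (h2 : U * Uᴴ = 1) (X : Matrix ι ι ℂ) :
    ‖toEuclideanCLM (𝕜 := ℂ) (Uᴴ * X * U)‖ = ‖toEuclideanCLM (𝕜 := ℂ) X‖ := by
  have hU : U ∈ unitary (Matrix ι ι ℂ) := ⟨h1, h2⟩
  simp only [← cstar_norm_def]
  rw [CStarRing.norm_mul_mem_unitary _ hU]
  exact CStarRing.norm_mem_unitary_mul _ (Unitary.star_mem hU)

open scoped Matrix.Norms.L2Operator in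
theorem norm_toEuclideanCLM_conjTranspose (X : Matrix ι ι ℂ) :
    ‖toEuclideanCLM (𝕜 := ℂ) Xᴴ‖ = ‖toEuclideanCLM (𝕜 := ℂ) X‖ := by
  simp only [← cstar_norm_def]
  exact l2_opNorm_conjTranspose X

theorem norm_toEuclideanCLM_submatrix (X : Matrix ι ι ℂ) (π : ι ≃ ι) :
    ‖toEuclideanCLM (𝕜 := ℂ) (X.submatrix π π)‖ = ‖toEuclideanCLM (𝕜 := ℂ) X‖ := by
  -- Reindexing is conjugation by the permutation matrix `P`, which is unitary.
  obtain ⟨P, hP⟩ : ∃ P : Matrix ι ι ℂ, P = (1 : Matrix ι ι ℂ).submatrix id π := ⟨_, rfl⟩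
  have hPH : Pᴴ = (1 : Matrix ι ι ℂ).submatrix π id := by
    rw [hP, conjTranspose_submatrix, conjTranspose_one]
  have h1 : Pᴴ * P = 1 := by
    rw [hPH, hP, ← Equiv.coe_refl, submatrix_mul_equiv, one_mul, submatrix_one_equiv]
  have h2 : P * Pᴴ = 1 := by
    rw [hPH, hP, submatrix_mul_equiv, one_mul, submatrix_id_id]
  rw [← norm_toEuclideanCLM_conj h1 h2 X]
  congr 2
  rw [hPH, hP]
  conv_rhs => rw [← submatrix_id_id X, ← Equiv.coe_refl, submatrix_mul_equiv, submatrix_mul_equiv,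
    one_mul, mul_one]

end Diagonalization

/-! ### Time averages of oscillating exponentials. -/

section TimeAverage

open Filter Topology

/-- The average of `exp (i ω t)` over `[0, τ]` tends to `0` unless `ω = 0`. -/
theorem tendsto_average_exp (ω : ℝ) :
    Tendsto (fun τ : ℝ => (1 / τ : ℂ) * ∫ t in (0 : ℝ)..τ, Complex.exp (Complex.I * t * ω))
      atTop (𝓝 (if ω = 0 then 1 else 0)) := by
  split_ifs with h
  · refine tendsto_const_nhds.congr' ?_
    filter_upwards [eventually_gt_atTop 0] with τ hτ
    have : (τ : ℂ) ≠ 0 := by exact_mod_cast hτ.ne'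
    simp [h, this]
  · have hc : Complex.I * ω ≠ 0 := mul_ne_zero Complex.I_ne_zero (by exact_mod_cast h)
    have hint : ∀ τ : ℝ, ∫ t in (0 : ℝ)..τ, Complex.exp (Complex.I * t * ω) =
        (Complex.exp (Complex.I * ω * τ) - 1) / (Complex.I * ω) := fun τ => by
      have := integral_exp_mul_complex (a := 0) (b := τ) hc
      rw [Complex.ofReal_zero, mul_zero, Complex.exp_zero] at this
      rw [← this]
      congr 1
      funext t
      ring_nf
    simp only [hint]
    rw [tendsto_zero_iff_norm_tendsto_zero]
    have hlim : Tendsto (fun τ : ℝ => 2 / |ω| * τ⁻¹) atTop (𝓝 0) := by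
      simpa using tendsto_inv_atTop_zero.const_mul (2 / |ω|)
    refine tendsto_of_tendsto_of_tendsto_of_le_of_le' tendsto_const_nhds hlim
      (Eventually.of_forall fun τ => norm_nonneg _) ?_
    filter_upwards [eventually_gt_atTop 0] with τ hτ
    have hn : ‖Complex.exp (Complex.I * ω * τ) - 1‖ ≤ 2 := by
      refine (norm_sub_le _ _).trans ?_
      rw [show Complex.I * ω * τ = ((ω * τ : ℝ) : ℂ) * Complex.I by push_cast; ring,
        Complex.norm_exp_ofReal_mul_I, norm_one]
      norm_num
    rw [norm_mul, norm_div, norm_div, norm_mul, Complex.norm_I, Complex.norm_real,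
      Complex.norm_real, norm_one, Real.norm_eq_abs, Real.norm_eq_abs, abs_of_pos hτ, one_mul,
      one_div, mul_comm]
    have : 0 < |ω| := abs_pos.2 h
    gcongr

end TimeAverage

/-! ### Translations of supports and exponential sums over the periodic lattice. -/

section Geometry

variable {D n d : ℕ}

theorem dist_add_right (i j a : Site D n) : dist (i + a) (j + a) = dist i j := by
  simp [dist]

theorem SupportedOn.conjTranspose {S : Set (Site D n)} {X : Op D n d} (hX : SupportedOn S X) :
    SupportedOn S X.conjTranspose := by
  obtain ⟨x, hx⟩ := hX
  refine ⟨x.conjTranspose, fun σ τ => ?_⟩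
  have hiff : (∀ j, j ∉ S → τ j = σ j) ↔ ∀ j, j ∉ S → σ j = τ j :=
    forall₂_congr fun j _ => eq_comm
  rw [Matrix.conjTranspose_apply, hx, Matrix.conjTranspose_apply]
  by_cases h : ∀ j, j ∉ S → σ j = τ j
  · rw [if_pos h, if_pos (hiff.2 h)]
  · rw [if_neg h, if_neg (hiff.not.2 h), star_zero]

theorem SupportedOn.translate {i : Site D n} {R : ℕ} {X : Op D n d}
    (hX : SupportedOn (ball i R) X) (a : Site D n) :
    SupportedOn (ball (i + a) R) (translate a X) := by
  obtain ⟨x, hx⟩ := hX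
  have hmem : ∀ j, j + a ∈ ball (i + a) R ↔ j ∈ ball i R := fun j => by
    simp only [ball, Set.mem_ofPred_eq, dist_add_right]
  refine ⟨fun u v => x (fun s => u ⟨s + a, (hmem s).2 s.2⟩) (fun s => v ⟨s + a, (hmem s).2 s.2⟩),
    fun σ τ => ?_⟩
  have hiff : (∀ j, j ∉ ball i R → σ (j + a) = τ (j + a)) ↔
      ∀ j, j ∉ ball (i + a) R → σ j = τ j := by
    constructor
    · intro h j hj
      have := h (j - a) (by rwa [← hmem, sub_add_cancel])
      rwa [sub_add_cancel] at this
    · exact fun h j hj => h _ (by rwa [hmem])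
  rw [SpinLattice.translate, Matrix.of_apply, hx]
  by_cases h : ∀ j, j ∉ ball (i + a) R → σ j = τ j
  · rw [if_pos h, if_pos (hiff.2 h)]
  · rw [if_neg h, if_neg (hiff.not.2 h)]

/-- The permutation of the configurations induced by a lattice translation. -/
def shift (a : Site D n) : Config D n d ≃ Config D n d :=
  (Equiv.addRight a).symm.arrowCongr (Equiv.refl _)

variable [NeZero n]

theorem sum_pow_val_le {q : ℝ} (h0 : 0 ≤ q) (h1 : q < 1) :
    ∑ x : ZMod n, q ^ x.val ≤ (1 - q)⁻¹ := by
  rw [← tsum_geometric_of_lt_one h0 h1,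
    ← Finset.sum_image (f := fun k => q ^ k) (g := ZMod.val) (ZMod.val_injective n).injOn]
  exact (summable_geometric_of_lt_one h0 h1).sum_le_tsum _ fun k _ => pow_nonneg h0 k

/-- The periodic distance is the shorter of the two ways around; adding the powers for both ways
avoids the minimum. -/
theorem pow_natAbs_valMinAbs_le {q : ℝ} (h0 : 0 ≤ q) (x : ZMod n) :
    q ^ x.valMinAbs.natAbs ≤ q ^ x.val + q ^ (-x).val := by
  rw [ZMod.valMinAbs_natAbs_eq_min]
  rcases le_total x.val (n - x.val) with h | h
  · rw [min_eq_left h]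
    exact le_add_of_nonneg_right (pow_nonneg h0 _)
  · rw [min_eq_right h, ZMod.neg_val]
    split_ifs with hx
    · have := NeZero.ne n
      simp only [hx, ZMod.val_zero] at h
      omega
    · exact le_add_of_nonneg_left (pow_nonneg h0 _)

/-- The distance is additive over coordinates, so the sum is the `D`-th power of a one-dimensional
sum, which two geometric series bound uniformly in `n`. -/
theorem sum_pow_dist_le {q : ℝ} (h0 : 0 ≤ q) (h1 : q < 1) (i : Site D n) :
    ∑ j, q ^ dist i j ≤ (2 * (1 - q)⁻¹) ^ D := by
  have h : ∑ j, q ^ dist i j = (∑ x : ZMod n, q ^ x.valMinAbs.natAbs) ^ D := by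
    rw [Fintype.sum_pow, ← (Equiv.subLeft i).sum_comp]
    refine Finset.sum_congr rfl fun j _ => ?_
    simp [dist, Finset.prod_pow_eq_pow_sum]
  rw [h]
  refine pow_le_pow_left₀ (Finset.sum_nonneg fun x _ => pow_nonneg h0 _) ?_ D
  refine (Finset.sum_le_sum fun x _ => pow_natAbs_valMinAbs_le h0 x).trans ?_
  have hneg : ∑ x : ZMod n, q ^ (-x).val = ∑ x : ZMod n, q ^ x.val :=
    Equiv.sum_comp (Equiv.neg (ZMod n)) fun x : ZMod n => q ^ x.val
  rw [Finset.sum_add_distrib, two_mul, hneg]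
  exact add_le_add (sum_pow_val_le h0 h1) (sum_pow_val_le h0 h1)

theorem sum_exp_neg_dist_div_le {ξ : ℝ} (hξ : 0 < ξ) (i : Site D n) :
    ∑ j, Real.exp (-(dist i j : ℝ) / ξ) ≤ 2 ^ D * (1 + ξ) ^ D := by
  -- This is `exp (1 / ξ) ≥ 1 + 1 / ξ` inverted; it turns the geometric factor `(1 - q)⁻¹` into `1 +
  -- ξ`.
  have hq : Real.exp (-(1 / ξ)) ≤ ξ / (1 + ξ) := by
    rw [Real.exp_neg]
    refine inv_le_of_inv_le₀ (by positivity) ?_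
    rw [inv_div, add_div, div_self hξ.ne']
    exact Real.add_one_le_exp _
  have hlt : Real.exp (-(1 / ξ)) < 1 :=
    hq.trans_lt ((div_lt_one (by positivity)).2 (by linarith))
  have h : ∀ j, Real.exp (-(dist i j : ℝ) / ξ) = Real.exp (-(1 / ξ)) ^ dist i j := fun j => by
    rw [← Real.exp_nat_mul]
    congr 1
    ring
  simp only [h]
  refine (sum_pow_dist_le (Real.exp_pos _).le hlt i).trans ?_
  rw [← mul_pow]
  have : (1 - Real.exp (-(1 / ξ)))⁻¹ ≤ 1 + ξ := by
    refine inv_le_of_inv_le₀ (by positivity) ?_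
    have : (1 + ξ)⁻¹ = 1 - ξ / (1 + ξ) := by field_simp; ring
    linarith
  have h0 : 0 ≤ (1 - Real.exp (-(1 / ξ)))⁻¹ := inv_nonneg.2 (by linarith)
  gcongr

end Geometry

/-! ### Operator norm bounds and the time-averaged correlator in the eigenbasis. -/

section Dynamics

open Matrix Filter Topology

variable {D n d : ℕ} [NeZero n]

theorem opNorm_nonneg (X : Op D n d) : 0 ≤ opNorm X := norm_nonneg _

theorem opNorm_mul_le (X Y : Op D n d) : opNorm (X * Y) ≤ opNorm X * opNorm Y := by
  unfold opNorm
  rw [map_mul]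
  exact norm_mul_le _ _

theorem opNorm_conjTranspose (X : Op D n d) : opNorm Xᴴ = opNorm X :=
  norm_toEuclideanCLM_conjTranspose X

theorem opNorm_translate (a : Site D n) (X : Op D n d) : opNorm (translate a X) = opNorm X :=
  norm_toEuclideanCLM_submatrix X (shift a)

theorem norm_conj_apply_self_le {U : Op D n d} (h1 : Uᴴ * U = 1) (h2 : U * Uᴴ = 1)
    (X : Op D n d) (m : Config D n d) : ‖(Uᴴ * X * U) m m‖ ≤ opNorm X :=
  (norm_apply_le_norm_toEuclideanCLM _ m m).trans (norm_toEuclideanCLM_conj h1 h2 X).le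

theorem norm_sum_mul_le_of_forall_le {ι : Type*} [Fintype ι] {p : ι → ℝ} (hp : ∀ m, 0 ≤ p m)
    (hp1 : ∑ m, p m = 1) {u : ι → ℂ} {c : ℝ} (hu : ∀ m, ‖u m‖ ≤ c) :
    ‖∑ m, (p m : ℂ) * u m‖ ≤ c := by
  calc ‖∑ m, (p m : ℂ) * u m‖ ≤ ∑ m, p m * c := norm_sum_le_of_le _ fun m _ => by
        rw [norm_mul, Complex.norm_real, Real.norm_of_nonneg (hp m)]
        exact mul_le_mul_of_nonneg_left (hu m) (hp m)
    _ = c := by rw [← Finset.sum_mul, hp1, one_mul]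

/-- Cauchy-Schwarz with weights `p`, each weight being split as `√(p m) * √(p m)`. -/
theorem norm_sum_mul_mul_le {ι : Type*} [Fintype ι] {p : ι → ℝ} (hp : ∀ m, 0 ≤ p m)
    (u v : ι → ℂ) :
    ‖∑ m, (p m : ℂ) * (u m * v m)‖ ≤
      √(∑ m, p m * ‖u m‖ ^ 2) * √(∑ m, p m * ‖v m‖ ^ 2) := by
  have hsq : ∀ (w : ι → ℂ) m, (√(p m) * ‖w m‖) ^ 2 = p m * ‖w m‖ ^ 2 := fun w m => by
    rw [mul_pow, Real.sq_sqrt (hp m)]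
  have h := Real.sum_mul_le_sqrt_mul_sqrt Finset.univ (fun m => √(p m) * ‖u m‖)
    fun m => √(p m) * ‖v m‖
  simp only [hsq] at h
  refine le_trans ?_ h
  refine norm_sum_le_of_le _ fun m _ => le_of_eq ?_
  rw [norm_mul, norm_mul, Complex.norm_real, Real.norm_of_nonneg (hp m)]
  nth_rewrite 1 [← Real.mul_self_sqrt (hp m)]
  ring

theorem expect_evolve_mul {U : Op D n d} (h1 : Uᴴ * U = 1) (h2 : U * Uᴴ = 1)
    (e : Config D n d → ℝ) (p : Config D n d → ℝ) (A B : Op D n d) (t : ℝ) :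
    expect (U * diagonal (fun m => (p m : ℂ)) * Uᴴ)
        (evolve (U * diagonal (fun m => (e m : ℂ)) * Uᴴ) t A * B) =
      ∑ m, ∑ l, p m * ((Uᴴ * A * U) m l * (Uᴴ * B * U) l m) *
        Complex.exp (Complex.I * t * (e m - e l : ℝ)) := by
  rw [expect, trace_conj_diagonal_mul, evolve, exp_smul_conj_diagonal h1 h2,
    exp_smul_conj_diagonal h1 h2]
  refine Finset.sum_congr rfl fun m _ => ?_
  have h : ∀ E F : Op D n d, Uᴴ * (U * E * Uᴴ * A * (U * F * Uᴴ) * B) * U =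
      (E * (Uᴴ * A * U) * F) * (Uᴴ * B * U) := fun E F => by
    calc _ = (Uᴴ * U) * E * Uᴴ * A * U * F * Uᴴ * B * U := by simp only [mul_assoc]
      _ = _ := by rw [h1, one_mul]; simp only [mul_assoc]
  rw [h, mul_apply, Finset.mul_sum]
  refine Finset.sum_congr rfl fun l _ => ?_
  rw [mul_diagonal, diagonal_mul, Complex.ofReal_sub, mul_sub, sub_eq_add_neg, Complex.exp_add,
    neg_mul]
  ring

/-- For a non-degenerate Hamiltonian the time average of a temporal correlator in a stationary
state converges to the correlator of the diagonal parts. -/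
theorem tendsto_timeAverage {U : Op D n d} (h1 : Uᴴ * U = 1) (h2 : U * Uᴴ = 1)
    {e : Config D n d → ℝ} (he : Function.Injective e) (p : Config D n d → ℝ) (A B : Op D n d) :
    Tendsto (timeAverage (U * diagonal (fun m => (e m : ℂ)) * Uᴴ)
        (U * diagonal (fun m => (p m : ℂ)) * Uᴴ) A B) atTop
      (𝓝 (∑ m, p m * ((Uᴴ * A * U) m m * (Uᴴ * B * U) m m))) := by
  have hfun : timeAverage (U * diagonal (fun m => (e m : ℂ)) * Uᴴ)
      (U * diagonal (fun m => (p m : ℂ)) * Uᴴ) A B = fun τ : ℝ =>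
      ∑ m, ∑ l, p m * ((Uᴴ * A * U) m l * (Uᴴ * B * U) l m) *
        ((1 / τ : ℂ) * ∫ t in (0 : ℝ)..τ, Complex.exp (Complex.I * t * (e m - e l : ℝ))) := by
    funext τ
    simp only [timeAverage, expect_evolve_mul h1 h2]
    rw [intervalIntegral.integral_finsetSum fun m _ =>
      Continuous.intervalIntegrable (by fun_prop) _ _, Finset.mul_sum]
    refine Finset.sum_congr rfl fun m _ => ?_
    rw [intervalIntegral.integral_finsetSum fun l _ =>
      Continuous.intervalIntegrable (by fun_prop) _ _, Finset.mul_sum]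
    refine Finset.sum_congr rfl fun l _ => ?_
    rw [intervalIntegral.integral_const_mul]
    ring
  -- Only the frequencies `e m - e l` occur, so distinct levels suffice to isolate `l = m`; energy
  -- gaps may coincide.
  have hlim : ∑ m, p m * ((Uᴴ * A * U) m m * (Uᴴ * B * U) m m) =
      ∑ m, ∑ l, p m * ((Uᴴ * A * U) m l * (Uᴴ * B * U) l m) *
        (if e m - e l = 0 then 1 else 0) := by
    refine Finset.sum_congr rfl fun m _ => ?_
    simp only [sub_eq_zero, he.eq_iff, mul_ite, mul_one, mul_zero, Finset.sum_ite_eq,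
      Finset.mem_univ, if_true]
  rw [hfun, hlim]
  exact tendsto_finsetSum _ fun m _ => tendsto_finsetSum _ fun l _ =>
    (tendsto_average_exp _).const_mul _

end Dynamics

/-! ### Fluctuations of diagonal entries, controlled by spatial correlations. -/

section Fluctuations

open Matrix Filter Topology

variable {D n d : ℕ} [NeZero n]

/-- In a stationary state of a non-degenerate translation-invariant Hamiltonian, the fluctuations
of the diagonal entries of an operator are bounded by the mean correlation of its translates. -/
theorem card_sq_mul_sum_fluctuation_le {U : Op D n d} (h1 : Uᴴ * U = 1) (h2 : U * Uᴴ = 1)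
    {e : Config D n d → ℂ} (he : Function.Injective e)
    (hH : IsTranslationInvariant (U * diagonal e * Uᴴ))
    {p : Config D n d → ℝ} (hp : ∀ m, 0 ≤ p m) (hp1 : ∑ m, p m = 1) {ρ : Op D n d}
    (hρ : ρ = U * diagonal (fun m => (p m : ℂ)) * Uᴴ) (X : Op D n d) :
    (Fintype.card (Site D n) : ℝ) ^ 2 * ∑ m, p m * ‖(Uᴴ * X * U) m m - expect ρ X‖ ^ 2 ≤
      ∑ a : Site D n, ∑ b : Site D n, ‖expect ρ ((translate a X)ᴴ * translate b X) -
        expect ρ (translate a X)ᴴ * expect ρ (translate b X)‖ := by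
  have hexp : ∀ Y, expect ρ Y = ∑ m, (p m : ℂ) * (Uᴴ * Y * U) m m := fun Y => by
    rw [expect, hρ, trace_conj_diagonal_mul]
  have hdiag : ∀ a m, (Uᴴ * translate a X * U) m m = (Uᴴ * X * U) m m := fun a m =>
    conj_submatrix_apply_self h1 h2 he (shift a) (hH a) X m
  have hα : ∀ a, expect ρ (translate a X) = expect ρ X := fun a => by
    rw [hexp, hexp]
    simp only [hdiag]
  have hstar : ∀ Y, expect ρ Yᴴ = star (expect ρ Y) := fun Y => by
    rw [hexp, hexp, star_sum]
    refine Finset.sum_congr rfl fun m _ => ?_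
    have : Uᴴ * Yᴴ * U = (Uᴴ * Y * U)ᴴ := by
      simp only [conjTranspose_mul, conjTranspose_conjTranspose, mul_assoc]
    rw [this, conjTranspose_apply, star_mul', Complex.star_def, Complex.conj_ofReal,
      ← Complex.star_def]
  have hadd : ∀ Y Z, expect ρ (Y - Z) = expect ρ Y - expect ρ Z := fun Y Z => by
    simp only [expect, mul_sub, trace_sub]
  have hsmul : ∀ (c : ℂ) Y, expect ρ (c • Y) = c * expect ρ Y := fun c Y => by
    simp only [expect, mul_smul_comm, trace_smul, smul_eq_mul]
  have hone : expect ρ 1 = 1 := by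
    rw [hexp]
    simp only [mul_one, h1, one_apply_eq]
    exact_mod_cast hp1
  obtain ⟨α, hαdef⟩ : ∃ α, α = expect ρ X := ⟨_, rfl⟩
  -- The centred translates all have the same diagonal entries, so those of their sum are `N` times
  -- those of one; this produces the factor `N ^ 2`.
  obtain ⟨Y, hY⟩ : ∃ Y : Site D n → Op D n d, Y = fun a => translate a X - α • 1 := ⟨_, rfl⟩
  have hYdiag : ∀ m, (Uᴴ * (∑ a, Y a) * U) m m =
      Fintype.card (Site D n) * ((Uᴴ * X * U) m m - α) := fun m => by
    have : ∀ a, (Uᴴ * Y a * U) m m = (Uᴴ * X * U) m m - α := fun a => by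
      rw [hY]
      simp only [mul_sub, sub_mul, Matrix.sub_apply, hdiag, mul_smul_comm, smul_mul_assoc, mul_one, h1,
        Matrix.smul_apply, one_apply_eq, smul_eq_mul]
    rw [Finset.mul_sum, Finset.sum_mul, Matrix.sum_apply]
    simp only [this, Finset.sum_const, Finset.card_univ, nsmul_eq_mul]
  have hcov : ∀ a b, expect ρ ((Y a)ᴴ * Y b) =
      expect ρ ((translate a X)ᴴ * translate b X) -
        expect ρ (translate a X)ᴴ * expect ρ (translate b X) := fun a b => by
    rw [hY]
    simp only [conjTranspose_sub, conjTranspose_smul, conjTranspose_one, sub_mul, mul_sub,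
      smul_mul_assoc, mul_smul_comm, one_mul, mul_one, hadd, hsmul, hone, hstar, hα, ← hαdef]
    ring
  have hsum : expect ρ ((∑ a, Y a)ᴴ * ∑ b, Y b) = ∑ a, ∑ b, expect ρ ((Y a)ᴴ * Y b) := by
    simp only [expect, conjTranspose_sum, Finset.sum_mul, Finset.mul_sum, trace_sum]
    exact Finset.sum_comm
  calc (Fintype.card (Site D n) : ℝ) ^ 2 * ∑ m, p m * ‖(Uᴴ * X * U) m m - expect ρ X‖ ^ 2
      = ∑ m, p m * ‖(Uᴴ * (∑ a, Y a) * U) m m‖ ^ 2 := by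
        rw [Finset.mul_sum]
        refine Finset.sum_congr rfl fun m _ => ?_
        rw [hYdiag, norm_mul, Complex.norm_natCast, hαdef]
        ring
    _ ≤ ∑ m, p m * ((Uᴴ * ((∑ a, Y a)ᴴ * ∑ a, Y a) * U) m m).re :=
        Finset.sum_le_sum fun m _ =>
          mul_le_mul_of_nonneg_left (sq_norm_apply_self_le h2 _ m) (hp m)
    _ = (expect ρ ((∑ a, Y a)ᴴ * ∑ b, Y b)).re := by
        rw [hexp, Complex.re_sum]
        simp only [Complex.re_ofReal_mul]
    _ ≤ ‖expect ρ ((∑ a, Y a)ᴴ * ∑ b, Y b)‖ := Complex.re_le_norm _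
    _ ≤ _ := by
        rw [hsum]
        simp only [hcov]
        exact norm_sum_le_of_le _ fun a _ => norm_sum_le _ _

/-- The constant in the bound for the mean correlation of the translates of a local operator. -/
noncomputable def correlationConst (D r₀ : ℕ) (M : ℝ) : ℝ :=
  2 * Real.exp r₀ * 4 ^ D + |M| * 2 ^ D

theorem correlationConst_pos (D r₀ : ℕ) (M : ℝ) : 0 < correlationConst D r₀ M := by
  unfold correlationConst
  positivity

/-- Translates at distance at most `r₀` get the trivial bound `2 ‖X‖ ^ 2`, the others the assumed
decay. The bound does not depend on `n`: a translate is correlated with about `(1 + ξ) ^ D` others.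
-/
theorem sum_correlation_le {R r₀ : ℕ} {M ξ : ℝ} (hξ : 0 < ξ) {ρ : Op D n d}
    (hnorm : ∀ X, ‖expect ρ X‖ ≤ opNorm X) {f : ℕ → ℝ} (hdecay : HasCorrelationDecay R ρ f)
    (hf : ∀ r : ℕ, r₀ < r → f r ≤ M * Real.exp (-(r : ℝ) / ξ))
    {i : Site D n} {X : Op D n d} (hX : SupportedOn (ball i R) X) (a : Site D n) :
    ∑ b : Site D n, ‖expect ρ ((translate a X)ᴴ * translate b X) -
        expect ρ (translate a X)ᴴ * expect ρ (translate b X)‖ ≤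
      opNorm X ^ 2 * (correlationConst D r₀ M * (1 + ξ) ^ D) := by
  have hX0 := opNorm_nonneg X
  have hterm : ∀ b : Site D n, ‖expect ρ ((translate a X)ᴴ * translate b X) -
        expect ρ (translate a X)ᴴ * expect ρ (translate b X)‖ ≤
      opNorm X ^ 2 * (2 * Real.exp r₀ * Real.exp (-(dist a b : ℝ) / 1) +
        |M| * Real.exp (-(dist a b : ℝ) / ξ)) := fun b => by
    have hna : opNorm (translate a X)ᴴ = opNorm X := by
      rw [opNorm_conjTranspose, opNorm_translate]
    rcases le_or_gt (dist a b) r₀ with h | h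
    · have hle : ‖expect ρ ((translate a X)ᴴ * translate b X) -
          expect ρ (translate a X)ᴴ * expect ρ (translate b X)‖ ≤ opNorm X ^ 2 * 2 := by
        have hm := (hnorm _).trans (opNorm_mul_le (translate a X)ᴴ (translate b X))
        have ha := hnorm (translate a X)ᴴ
        have hb := hnorm (translate b X)
        rw [hna, opNorm_translate] at hm
        rw [hna] at ha
        rw [opNorm_translate] at hb
        refine (norm_sub_le _ _).trans ?_
        rw [norm_mul]
        have := mul_le_mul ha hb (norm_nonneg _) hX0
        linarith
      refine hle.trans (mul_le_mul_of_nonneg_left ?_ (sq_nonneg _))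
      -- The near pairs are majorized by an exponential of decay length `1`, so that
      -- `sum_exp_neg_dist_div_le` handles both regimes.
      have h1 : 1 ≤ Real.exp r₀ * Real.exp (-(dist a b : ℝ) / 1) := by
        rw [← Real.exp_add]
        refine Real.one_le_exp ?_
        have : (dist a b : ℝ) ≤ r₀ := by exact_mod_cast h
        linarith
      have h3 : 0 ≤ |M| * Real.exp (-(dist a b : ℝ) / ξ) := by positivity
      linarith
    · have hle := hdecay (i + a) (i + b) _ _ (hX.translate a).conjTranspose (hX.translate b)
      rw [hna, opNorm_translate, add_comm i a, add_comm i b, dist_add_right, ← sq] at hle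
      refine hle.trans (mul_le_mul_of_nonneg_left ?_ (sq_nonneg _))
      have h2 : M * Real.exp (-(dist a b : ℝ) / ξ) ≤ |M| * Real.exp (-(dist a b : ℝ) / ξ) :=
        mul_le_mul_of_nonneg_right (le_abs_self M) (Real.exp_pos _).le
      have h3 : 0 ≤ 2 * Real.exp r₀ * Real.exp (-(dist a b : ℝ) / 1) := by positivity
      linarith [hf _ h]
  refine (Finset.sum_le_sum fun b _ => hterm b).trans ?_
  rw [← Finset.mul_sum, Finset.sum_add_distrib, ← Finset.mul_sum, ← Finset.mul_sum]
  refine mul_le_mul_of_nonneg_left ?_ (sq_nonneg _)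
  have hnear : ∑ b, Real.exp (-(dist a b : ℝ) / 1) ≤ 4 ^ D * (1 + ξ) ^ D := by
    refine (sum_exp_neg_dist_div_le one_pos a).trans ?_
    rw [← mul_pow, one_add_one_eq_two, show (2 : ℝ) * 2 = 4 by norm_num]
    have h1 : (1 : ℝ) ≤ (1 + ξ) ^ D := one_le_pow₀ (by linarith)
    exact le_mul_of_one_le_right (by positivity) h1
  have hfar := sum_exp_neg_dist_div_le hξ a
  calc _ ≤ 2 * Real.exp r₀ * (4 ^ D * (1 + ξ) ^ D) + |M| * (2 ^ D * (1 + ξ) ^ D) := by gcongr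
    _ = _ := by unfold correlationConst; ring

/-- The time-averaged temporal correlator of local operators in a stationary state with decaying
correlations factorizes up to `O((1 + ξ) ^ D / N)`. -/
theorem exists_tendsto_timeAverage_norm_sub_le {k R r₀ : ℕ} {M ξ : ℝ} (hξ : 0 < ξ)
    {H ρ : Op D n d} (hloc : IsLocalHamiltonian k H) (hinv : IsTranslationInvariant H)
    (hsimple : HasSimpleSpectrum H) (hρ : IsDensityMatrix ρ) (hcomm : ρ * H = H * ρ)
    {f : ℕ → ℝ} (hdecay : HasCorrelationDecay R ρ f)
    (hf : ∀ r : ℕ, r₀ < r → f r ≤ M * Real.exp (-(r : ℝ) / ξ))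
    {i j : Site D n} {A B : Op D n d} (hA : SupportedOn (ball i R) A)
    (hB : SupportedOn (ball j R) B) :
    ∃ L : ℂ, Tendsto (timeAverage H ρ A B) atTop (𝓝 L) ∧
      ‖L - expect ρ A * expect ρ B‖ ≤
        opNorm A * opNorm B * (correlationConst D r₀ M * (1 + ξ) ^ D / (n : ℝ) ^ D) ∧
      ‖L - expect ρ A * expect ρ B‖ ≤ 2 * (opNorm A * opNorm B) := by
  have hherm : H.IsHermitian := by
    obtain ⟨h, hh, rfl⟩ := hloc
    rw [IsHermitian, conjTranspose_sum]
    exact Finset.sum_congr rfl fun i _ => (hh i).1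
  obtain ⟨U, h1, h2, e, he, hHe, p, hp, hp1, hρp⟩ :=
    exists_simultaneous_diagonalization hherm hsimple hρ.1 hρ.2 hcomm
  have he' : Function.Injective fun m => (e m : ℂ) := Complex.ofReal_injective.comp he
  have hexp : ∀ Y, expect ρ Y = ∑ m, (p m : ℂ) * (Uᴴ * Y * U) m m := fun Y => by
    rw [expect, hρp, trace_conj_diagonal_mul]
  have hnorm : ∀ Y, ‖expect ρ Y‖ ≤ opNorm Y := fun Y => by
    rw [hexp]
    exact norm_sum_mul_le_of_forall_le hp hp1 fun m => norm_conj_apply_self_le h1 h2 Y m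
  have hpC : ∑ m, (p m : ℂ) = 1 := by exact_mod_cast hp1
  have hN : (0 : ℝ) < (n : ℝ) ^ D := by
    have : 0 < n := Nat.pos_of_ne_zero (NeZero.ne n)
    positivity
  obtain ⟨K, hK⟩ : ∃ K, K = correlationConst D r₀ M * (1 + ξ) ^ D / (n : ℝ) ^ D := ⟨_, rfl⟩
  have hK0 : 0 ≤ K := by
    have := correlationConst_pos D r₀ M
    rw [hK]
    positivity
  have hfluct : ∀ (l : Site D n) (X : Op D n d), SupportedOn (ball l R) X →
      √(∑ m, p m * ‖(Uᴴ * X * U) m m - expect ρ X‖ ^ 2) ≤ opNorm X * √K := fun l X hX => by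
    have hle := card_sq_mul_sum_fluctuation_le h1 h2 he' (hHe ▸ hinv) hp hp1 hρp X
    have hsum := hle.trans (Finset.sum_le_sum fun a _ =>
      sum_correlation_le hξ hnorm hdecay hf hX a)
    have hcard : (Fintype.card (Site D n) : ℝ) = (n : ℝ) ^ D := by
      simp [Site, ZMod.card]
    rw [Finset.sum_const, Finset.card_univ, nsmul_eq_mul, hcard] at hsum
    rw [← Real.sqrt_sq (opNorm_nonneg X), ← Real.sqrt_mul (sq_nonneg _)]
    -- The sum over `a` contributes one factor `N` against `N ^ 2` on the left, which leaves `1 /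
    -- N`.
    refine Real.sqrt_le_sqrt (le_of_mul_le_mul_left (hsum.trans_eq ?_) (pow_pos hN 2))
    rw [hK]
    field_simp
  -- The deviation is a covariance, because `expect ρ` is the `p`-mean of the diagonal entries.
  have hdiff : (∑ m, (p m : ℂ) * ((Uᴴ * A * U) m m * (Uᴴ * B * U) m m)) -
      expect ρ A * expect ρ B =
      ∑ m, (p m : ℂ) * (((Uᴴ * A * U) m m - expect ρ A) * ((Uᴴ * B * U) m m - expect ρ B)) := by
    have : ∀ m, (p m : ℂ) * (((Uᴴ * A * U) m m - expect ρ A) *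
        ((Uᴴ * B * U) m m - expect ρ B)) =
        (p m : ℂ) * ((Uᴴ * A * U) m m * (Uᴴ * B * U) m m) -
        expect ρ A * ((p m : ℂ) * (Uᴴ * B * U) m m) -
        expect ρ B * ((p m : ℂ) * (Uᴴ * A * U) m m) + expect ρ A * expect ρ B * p m :=
      fun m => by ring
    simp only [this, Finset.sum_add_distrib, Finset.sum_sub_distrib, ← Finset.mul_sum, ← hexp,
      hpC]
    ring
  refine ⟨∑ m, (p m : ℂ) * ((Uᴴ * A * U) m m * (Uᴴ * B * U) m m), ?_, ?_, ?_⟩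
  · rw [hHe, hρp]
    exact tendsto_timeAverage h1 h2 he p A B
  · rw [hdiff, ← hK]
    refine (norm_sum_mul_mul_le hp _ _).trans ?_
    calc _ ≤ (opNorm A * √K) * (opNorm B * √K) :=
          mul_le_mul (hfluct i A hA) (hfluct j B hB) (Real.sqrt_nonneg _)
            (mul_nonneg (opNorm_nonneg A) (Real.sqrt_nonneg _))
      _ = opNorm A * opNorm B * (√K * √K) := by ring
      _ = _ := by rw [Real.mul_self_sqrt hK0]
  · have hL : ‖∑ m, (p m : ℂ) * ((Uᴴ * A * U) m m * (Uᴴ * B * U) m m)‖ ≤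
        opNorm A * opNorm B :=
      norm_sum_mul_le_of_forall_le hp hp1 fun m => by
        rw [norm_mul]
        exact mul_le_mul (norm_conj_apply_self_le h1 h2 A m) (norm_conj_apply_self_le h1 h2 B m)
          (norm_nonneg _) (opNorm_nonneg A)
    refine (norm_sub_le _ _).trans ?_
    rw [norm_mul]
    have := mul_le_mul (hnorm A) (hnorm B) (norm_nonneg _) (opNorm_nonneg A)
    linarith

end Fluctuations

/-! ### Comparison of `ξ ^ D / N` with the stated rate. -/

theorem rpow_mul_rpow_eq_div_rpow {D : ℕ} {ξ N : ℝ} (hξ : 0 ≤ ξ) (hN : 0 < N) :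
    ξ ^ (2 * (D : ℝ) / (D + 1)) * N ^ (-(2 : ℝ) / (D + 1)) =
      (ξ ^ D / N) ^ ((2 : ℝ) / (D + 1)) := by
  rw [Real.div_rpow (pow_nonneg hξ D) hN.le, ← Real.rpow_natCast, ← Real.rpow_mul hξ, neg_div,
    Real.rpow_neg hN.le, div_eq_mul_inv]
  congr 2
  ring

end SpinLattice

theorem mainTheorem3 (D d k R : ℕ) (hD : 1 ≤ D) (M : ℝ) (r₀ : ℕ) :
    ∃ C : ℝ, 0 < C ∧ ∀ ξ₀ : ℝ, 0 < ξ₀ → ∃ n₀ : ℕ,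
      ∀ (n : ℕ) [NeZero n], n₀ ≤ n → ∀ ξ : ℝ, ξ₀ ≤ ξ →
      ∀ H : SpinLattice.Op D n d,
        SpinLattice.IsLocalHamiltonian k H → SpinLattice.IsTranslationInvariant H →
        SpinLattice.HasSimpleSpectrum H →
      ∀ ρ : SpinLattice.Op D n d, SpinLattice.IsDensityMatrix ρ → ρ * H = H * ρ →
      ∀ f : ℕ → ℝ, SpinLattice.HasCorrelationDecay R ρ f →
        (∀ r : ℕ, r₀ < r → f r ≤ M * Real.exp (-(r : ℝ) / ξ)) →
      ∀ (i j : SpinLattice.Site D n) (A B : SpinLattice.Op D n d),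
        SpinLattice.SupportedOn (SpinLattice.ball i R) A →
        SpinLattice.SupportedOn (SpinLattice.ball j R) B →
        ∃ L : ℂ,
          Filter.Tendsto (SpinLattice.timeAverage H ρ A B) Filter.atTop (nhds L) ∧
          ‖L - SpinLattice.expect ρ A * SpinLattice.expect ρ B‖ ≤
            C * SpinLattice.opNorm A * SpinLattice.opNorm B *
              (ξ ^ (2 * (D : ℝ) / (D + 1)) * ((n : ℝ) ^ D) ^ (-(2 : ℝ) / (D + 1)) *
                Real.log ((n : ℝ) ^ D) ^ 2) := by
  have hc := SpinLattice.correlationConst_pos D r₀ M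
  obtain ⟨c, hcdef⟩ : ∃ c, c = SpinLattice.correlationConst D r₀ M := ⟨_, rfl⟩
  rw [← hcdef] at hc
  -- The summand `c` serves the case `x ≤ 1` below, the summand `2` the trivial bound for `x ≥ 1`.
  refine ⟨c + 2, by linarith, fun ξ₀ hξ₀ => ?_⟩
  -- `K` is the cost of replacing `(1 + ξ) ^ D` by `ξ ^ D` when `ξ ≥ ξ₀`. The choice of `n₀` makes
  -- `log n ≥ K ≥ 1`, so `log² N` pays for it and `C` stays independent of `ξ₀`.
  obtain ⟨K, hK⟩ : ∃ K : ℝ, K = (1 + 1 / ξ₀) ^ D := ⟨_, rfl⟩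
  have hK1 : 1 ≤ K := by
    rw [hK]
    exact one_le_pow₀ (le_add_of_nonneg_right (by positivity))
  refine ⟨⌈Real.exp K⌉₊, ?_⟩
  intro n _ hn ξ hξξ₀ H hloc hinv hsimple ρ hρ hcomm f hdecay hf i j A B hA hB
  have hξ : 0 < ξ := hξ₀.trans_le hξξ₀
  obtain ⟨L, hL, hdev, htriv⟩ := SpinLattice.exists_tendsto_timeAverage_norm_sub_le hξ hloc hinv
    hsimple hρ hcomm hdecay hf hA hB
  refine ⟨L, hL, ?_⟩
  rw [← hcdef] at hdev
  have hnR : Real.exp K ≤ n := Nat.ceil_le.1 hn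
  have hn0 : (0 : ℝ) < n := (Real.exp_pos K).trans_le hnR
  have hN : (0 : ℝ) < (n : ℝ) ^ D := pow_pos hn0 D
  have hlog : K ≤ Real.log ((n : ℝ) ^ D) ^ 2 := by
    have h : K ≤ Real.log n := (Real.le_log_iff_exp_le hn0).2 hnR
    have hD' : (1 : ℝ) ≤ D := by exact_mod_cast hD
    rw [Real.log_pow]
    nlinarith [mul_le_mul hD' h (by linarith) (by linarith)]
  have hAB : 0 ≤ SpinLattice.opNorm A * SpinLattice.opNorm B :=
    mul_nonneg (SpinLattice.opNorm_nonneg A) (SpinLattice.opNorm_nonneg B)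
  rw [SpinLattice.rpow_mul_rpow_eq_div_rpow hξ.le hN]
  obtain ⟨x, hx⟩ : ∃ x : ℝ, x = ξ ^ D / (n : ℝ) ^ D := ⟨_, rfl⟩
  have hx0 : 0 < x := by rw [hx]; positivity
  -- Here `D ≥ 1` matters: it gives `x ≤ x ^ (2 / (D + 1))` for `x ≤ 1`.
  have hs1 : (2 : ℝ) / (D + 1) ≤ 1 := by
    have hD' : (1 : ℝ) ≤ D := by exact_mod_cast hD
    rw [div_le_one (by linarith)]
    linarith
  rw [← hx, mul_assoc (c + 2), mul_comm (c + 2), mul_assoc]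
  rcases le_total x 1 with hx1 | hx1
  · refine hdev.trans (mul_le_mul_of_nonneg_left ?_ hAB)
    have hpow : (1 + ξ) ^ D ≤ K * ξ ^ D := by
      rw [hK, ← mul_pow]
      refine pow_le_pow_left₀ (by positivity) ?_ D
      rw [add_mul, one_mul, one_div_mul_eq_div, add_comm ξ]
      gcongr
      exact (one_le_div hξ₀).2 hξξ₀
    have hxs : x ≤ x ^ ((2 : ℝ) / (D + 1)) := by
      simpa using Real.rpow_le_rpow_of_exponent_ge hx0 hx1 hs1
    calc c * (1 + ξ) ^ D / (n : ℝ) ^ D ≤ c * (K * ξ ^ D) / (n : ℝ) ^ D := by gcongr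
      _ = c * (x * K) := by rw [hx]; ring
      _ ≤ (c + 2) * (x ^ ((2 : ℝ) / (D + 1)) * Real.log ((n : ℝ) ^ D) ^ 2) := by
        gcongr
        linarith
  · rw [mul_comm 2] at htriv
    refine htriv.trans (mul_le_mul_of_nonneg_left ?_ hAB)
    have hxs : 1 ≤ x ^ ((2 : ℝ) / (D + 1)) := Real.one_le_rpow hx1 (by positivity)
    have := one_le_mul_of_one_le_of_one_le hxs (hK1.trans hlog)
    nlinarith
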